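/- All groups and digraphs are finite, and digraphs have no loops; a digraph is a *graph* if the reverse of each of its arcs is an arc, and *proper* otherwise. For a group $G$ and $S\subseteq G\setminus\{1\}$, the *Cayley digraph* $\mathrm{Cay}(G,S)$ has vertex set $G$ and an arc $(u,v)$ whenever $vu^{-1}\in S$; its *Cayley index* is the index in its automorphism group of the right regular representation of $G$. The complement $\overline{\Gamma}$ has as arcs the pairs of distinct vertices that are not arcs of $\Gamma$. The cartesian product $\Gamma\square\Delta$ has vertex set $V(\Gamma)\times V(\Delta)$, with $((u,v),(u',v'))$ an arc if and only if either $u=u'$ and $(v,v')$ is an arc of $\Delta$, or $v=v'$ and $(u,u')$ is an arc of $\Gamma$. **Corollary 2.5.** Let $\Gamma_1$ be a proper Cayley digraph on a group $G$ with Cayley index $i_1$, and let $\Gamma_2$ be a (weakly) connected Cayley digraph (for instance, a connected Cayley graph) on a group $H$ with Cayley index $i_2$, where $i_1>i_2$. Then for at least one $\Delta\in\{\Gamma_1,\overline{\Gamma_1}\}$, the automorphism group of $\Delta\square\Gamma_2$ is equal to $\mathrm{Aut}(\Gamma_1)\times\mathrm{Aut}(\Gamma_2)$ in its coordinatewise action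 on $G\times H$, and $\Delta\square\Gamma_2$ is a proper Cayley digraph on $G\times H$ with Cayley index $i_1i_2$. -/

import Mathlib

/-- A digraph in the sense used here: a set of arcs, each an ordered pair of distinct vertices
(so there are no loops). -/
structure LooplessDigraph (V : Type*) extends Digraph V where
  loopless : ∀ v, ¬ Adj v v

namespace LooplessDigraph

variable {V W : Type*}

/-- A digraph is a graph if all its arcs can be reversed. -/
def IsGraph (Γ : LooplessDigraph V) : Prop :=
  ∀ u v, Γ.Adj u v → Γ.Adj v u

/-- A digraph is proper if it is not a graph. -/
def IsProper (Γ : LooplessDigraph V) : Prop :=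
  ¬ Γ.IsGraph

/-- The complement: two distinct vertices form an arc iff they did not form one before. -/
def complement (Γ : LooplessDigraph V) : LooplessDigraph V where
  Adj u v := u ≠ v ∧ ¬ Γ.Adj u v
  loopless _ h := h.1 rfl

/-- The cartesian product of two digraphs. -/
def boxProd (Γ : LooplessDigraph V) (Δ : LooplessDigraph W) : LooplessDigraph (V × W) where
  Adj x y := (x.1 = y.1 ∧ Δ.Adj x.2 y.2) ∨ (x.2 = y.2 ∧ Γ.Adj x.1 y.1)
  loopless _ h := h.elim (fun h => Δ.loopless _ h.2) (fun h => Γ.loopless _ h.2)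

/-- A digraph is weakly connected if its underlying simple graph is connected. -/
def IsWeaklyConnected (Γ : LooplessDigraph V) : Prop :=
  (SimpleGraph.fromRel Γ.Adj).Connected

/-- The automorphism group of a digraph, as a group of permutations of the vertices. -/
def aut (Γ : LooplessDigraph V) : Subgroup (Equiv.Perm V) where
  carrier := {σ | ∀ u v, Γ.Adj (σ u) (σ v) ↔ Γ.Adj u v}
  one_mem' _ _ := Iff.rfl
  mul_mem' {σ τ} hσ hτ u v := (hσ (τ u) (τ v)).trans (hτ u v)
  inv_mem' {σ} hσ u v := by
    have h := hσ (σ⁻¹ u) (σ⁻¹ v)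
    change Γ.Adj (σ (σ.symm u)) (σ (σ.symm v)) ↔ _ at h
    rw [Equiv.apply_symm_apply, Equiv.apply_symm_apply] at h
    exact h.symm

/-- The Cayley digraph on the group `G` with connection set `S`, where `S` does not contain the
identity: `(u, v)` is an arc iff `v * u⁻¹ ∈ S`. -/
def cayley {G : Type*} [Group G] (S : Set G) (hS : (1 : G) ∉ S) : LooplessDigraph G where
  Adj u v := v * u⁻¹ ∈ S
  loopless v h := hS (by rwa [mul_inv_cancel] at h)

/-- A digraph with vertex set `G` is a Cayley digraph on `G` if it is the Cayley digraph of some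
connection set. -/
def IsCayley {G : Type*} [Group G] (Γ : LooplessDigraph G) : Prop :=
  ∃ (S : Set G) (hS : (1 : G) ∉ S), Γ = cayley S hS

end LooplessDigraph

/-- The right regular representation of `G`, i.e. the group of all permutations `x ↦ x * g`
of `G`. -/
def rightRegular (G : Type*) [Group G] : Subgroup (Equiv.Perm G) :=
  (MulAction.toPermHom Gᵐᵒᵖ G).range

/-- The Cayley index of a Cayley digraph on `G`: the index in its automorphism group of `G`, the
latter being identified with its right regular representation. -/
noncomputable def LooplessDigraph.cayleyIndex {G : Type*} [Group G] (Γ : LooplessDigraph G) : ℕ :=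
  (rightRegular G).relIndex Γ.aut

/-- The direct product of two permutation groups in its coordinatewise action on `V × W`. -/
def permGroupProd {V W : Type*} (A : Subgroup (Equiv.Perm V)) (B : Subgroup (Equiv.Perm W)) :
    Subgroup (Equiv.Perm (V × W)) where
  carrier := {σ | ∃ a ∈ A, ∃ b ∈ B, ∀ v w, σ (v, w) = (a v, b w)}
  one_mem' := ⟨1, A.one_mem, 1, B.one_mem, fun _ _ => rfl⟩
  mul_mem' := by
    rintro σ τ ⟨a, ha, b, hb, h⟩ ⟨a', ha', b', hb', h'⟩
    exact ⟨a * a', A.mul_mem ha ha', b * b', B.mul_mem hb hb', fun v w => by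
      simp [Equiv.Perm.mul_apply, h, h']⟩
  inv_mem' := by
    rintro σ ⟨a, ha, b, hb, h⟩
    exact ⟨a⁻¹, A.inv_mem ha, b⁻¹, B.inv_mem hb, fun v w => by
      rw [Equiv.Perm.inv_eq_iff_eq, h]; simp⟩

/-! A proper digraph or its complement is both weakly connected and indecomposable under the
cartesian product (`IsProper.exists_isWeaklyConnected_isIndecomposable`). Indeed, if a digraph
splits, vertices differing in both coordinates are joined in the complement, and these arcs with the
reverses of one-way arcs keep the complement connected and unsplit.

Let `Δ` be the one so obtained. An automorphism `σ` of `Δ □ Γ₂` preserves geodesics, so it maps a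
layer `G × {w}` onto a box, which gives a factorization of `Δ` (`isFactorization_of_mem_aut`). By
indecomposability the image lies in a single `G`-layer or a single `H`-layer. The latter would embed
point stabilizers of `Δ` into those of `Γ₂` (`card_stabilizer_le`), impossible since their orders
are `i₁ > i₂`. So `σ` carries `G`-layers to `G`-layers and acts coordinatewise
(`mem_permGroupProd_of_layers`); the Cayley index follows by counting. -/

namespace LooplessDigraph

/-! ### Cartesian factorizations and complements -/

variable {V : Type*}

/-- A pair of equivalence relations presents `Γ` as a cartesian product: the classes of `r` and of
`s` are the fibres of the projections to the two factors. -/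
structure IsFactorization (Γ : LooplessDigraph V) (r s : Setoid V) : Prop where
  eq_of_rel : ∀ {x y}, r x y → s x y → x = y
  exists_corner : ∀ x y, ∃ z, r x z ∧ s z y
  rel_of_adj : ∀ {x y}, Γ.Adj x y → r x y ∨ s x y
  adj_iff_left : ∀ {x y x' y'}, r x x' → r y y' → s x y → s x' y' → (Γ.Adj x y ↔ Γ.Adj x' y')
  adj_iff_right : ∀ {x y x' y'}, s x x' → s y y' → r x y → r x' y' → (Γ.Adj x y ↔ Γ.Adj x' y')

/-- A digraph all of whose cartesian factorizations have a factor with at most one vertex. -/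
def IsIndecomposable (Γ : LooplessDigraph V) : Prop :=
  ∀ r s : Setoid V, Γ.IsFactorization r s → (∀ x y, r x y) ∨ (∀ x y, s x y)

theorem IsFactorization.swap {Γ : LooplessDigraph V} {r s : Setoid V}
    (h : Γ.IsFactorization r s) : Γ.IsFactorization s r where
  eq_of_rel h₁ h₂ := h.eq_of_rel h₂ h₁
  exists_corner x y := by
    obtain ⟨z, h₁, h₂⟩ := h.exists_corner y x
    exact ⟨z, s.symm h₂, r.symm h₁⟩
  rel_of_adj h₁ := (h.rel_of_adj h₁).symm
  adj_iff_left := h.adj_iff_right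
  adj_iff_right := h.adj_iff_left

theorem complement_complement (Γ : LooplessDigraph V) : Γ.complement.complement = Γ := by
  obtain ⟨⟨Adj⟩, hl⟩ := Γ
  simp only [complement, mk.injEq, Digraph.mk.injEq]
  ext u v
  constructor
  · rintro ⟨h₁, h₂⟩
    by_contra h
    exact h₂ ⟨h₁, h⟩
  · intro h
    exact ⟨fun e => hl u (by subst e; exact h), fun h' => h'.2 h⟩

theorem ne_of_adj (Γ : LooplessDigraph V) {u v : V} (h : Γ.Adj u v) : u ≠ v := by
  rintro rfl
  exact Γ.loopless _ h

theorem isProper_iff {Γ : LooplessDigraph V} :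
    Γ.IsProper ↔ ∃ u v, Γ.Adj u v ∧ ¬ Γ.Adj v u := by
  simp only [IsProper, IsGraph, not_forall, exists_prop]

theorem IsProper.complement {Γ : LooplessDigraph V} (h : Γ.IsProper) : Γ.complement.IsProper := by
  obtain ⟨u, v, h₁, h₂⟩ := isProper_iff.1 h
  exact isProper_iff.2 ⟨v, u, ⟨(Γ.ne_of_adj h₁).symm, h₂⟩, fun h' => h'.2 h₁⟩

theorem exists_not_rel {r : Setoid V} (h : ¬ ∀ x y, r x y) (x : V) : ∃ w, ¬ r x w := by
  by_contra! H
  exact h fun y z => r.trans (r.symm (H y)) (H z)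

theorem IsFactorization.complement_adj {Γ : LooplessDigraph V} {r s : Setoid V}
    (h : Γ.IsFactorization r s) {x y : V} (hr : ¬ r x y) (hs : ¬ s x y) :
    Γ.complement.Adj x y :=
  ⟨fun e => hr (e ▸ r.refl x), fun ha => (h.rel_of_adj ha).elim hr hs⟩

theorem reachable_of_adj {Γ : LooplessDigraph V} {x y : V} (h : Γ.Adj x y) :
    (SimpleGraph.fromRel Γ.Adj).Reachable x y :=
  SimpleGraph.Adj.reachable ((SimpleGraph.fromRel_adj _ _ _).2 ⟨Γ.ne_of_adj h, Or.inl h⟩)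

/-- A vertex outside the `s`-class of `x` and `y` is `r`-related to at most one of them, so the
complement joins it to the other; the reversed arc joins `y` to `x`. Vertices inside the class other
than `x` are joined to a vertex outside. -/
theorem IsFactorization.complement_isWeaklyConnected_of_rel {Γ : LooplessDigraph V}
    {r s : Setoid V} (h : Γ.IsFactorization r s) (hs : ¬ ∀ x y, s x y) {x y : V} (hxy : s x y)
    (ha : Γ.Adj x y) (hna : ¬ Γ.Adj y x) : Γ.complement.IsWeaklyConnected := by
  have hne := Γ.ne_of_adj ha
  have hyx : (SimpleGraph.fromRel Γ.complement.Adj).Reachable y x :=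
    reachable_of_adj (Γ := Γ.complement) ⟨hne.symm, hna⟩
  have hoff : ∀ z, ¬ s x z → (SimpleGraph.fromRel Γ.complement.Adj).Reachable z x := by
    intro z hz
    by_cases hrx : r x z
    · have hry : ¬ r y z := fun hry => hne (h.eq_of_rel (r.trans hrx (r.symm hry)) hxy)
      exact (reachable_of_adj (h.complement_adj hry fun h' => hz (s.trans hxy h'))).symm.trans hyx
    · exact (reachable_of_adj (h.complement_adj hrx hz)).symm
  have hall : ∀ z, (SimpleGraph.fromRel Γ.complement.Adj).Reachable z x := by
    intro z
    by_cases hz : s x z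
    · obtain ⟨w, hw⟩ := exists_not_rel hs x
      obtain ⟨w', hxw', hw'w⟩ := h.exists_corner x w
      have key : ∀ u, s u w → ¬ r z u →
          (SimpleGraph.fromRel Γ.complement.Adj).Reachable z x := by
        intro u hu hzu
        have hxu : ¬ s x u := fun h' => hw (s.trans h' hu)
        exact (reachable_of_adj (h.complement_adj hzu fun h' => hxu (s.trans hz h'))).trans
          (hoff u hxu)
      by_cases hzw : r z w'
      · rw [h.eq_of_rel (r.trans hxw' (r.symm hzw)) hz]
      · exact key w' hw'w hzw
    · exact hoff z hz
  exact (SimpleGraph.connected_iff _).2 ⟨fun u v => (hall u).trans (hall v).symm, ⟨x⟩⟩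

theorem IsFactorization.complement_isWeaklyConnected {Γ : LooplessDigraph V}
    {r s : Setoid V} (h : Γ.IsFactorization r s) (hr : ¬ ∀ x y, r x y) (hs : ¬ ∀ x y, s x y)
    (hp : Γ.IsProper) : Γ.complement.IsWeaklyConnected := by
  obtain ⟨x, y, ha, hna⟩ := isProper_iff.1 hp
  rcases h.rel_of_adj ha with hxy | hxy
  · exact h.swap.complement_isWeaklyConnected_of_rel hr hxy ha hna
  · exact h.complement_isWeaklyConnected_of_rel hs hxy ha hna

/-- In the complement `z` is joined to `x` or `y`, and each such arc lies in an `r'`- or an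
`s'`-class. As `s' x y`, one `s'`-step from either end suffices, while `r'`-steps from both ends
would give `r' x y`. -/
theorem IsFactorization.rel_of_not_rel {Γ : LooplessDigraph V} {r s r' s' : Setoid V}
    (h : Γ.IsFactorization r s) (h' : Γ.complement.IsFactorization r' s') {x y : V}
    (ha : Γ.Adj x y) (hna : ¬ Γ.Adj y x) (hs : s x y) (hs' : s' x y) {z : V} (hz : ¬ s x z) :
    s' x z := by
  have hne := Γ.ne_of_adj ha
  have hnr : ¬ r x y := fun hr => hne (h.eq_of_rel hr hs)
  have hnr' : ¬ r' x y := fun hr => hne (h'.eq_of_rel hr hs')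
  have hcyx : Γ.complement.Adj y x := ⟨hne.symm, hna⟩
  have hx : ∀ {w}, ¬ s x w → ¬ r x w → r' x w ∨ s' x w := fun h₁ h₂ =>
    h'.rel_of_adj (h.complement_adj h₂ h₁)
  have hy : ∀ {w}, ¬ s x w → ¬ r y w → r' y w ∨ s' y w := fun h₁ h₂ =>
    h'.rel_of_adj (h.complement_adj h₂ fun h₃ => h₁ (s.trans hs h₃))
  -- Parallel copies of the one-way arc are one-way too, so their reverses are arcs of the
  -- complement.
  have mixed : ∀ {u w}, r x u → r y w → s u w →
      Γ.Adj u w ∧ (r' u w ∨ s' u w) := by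
    intro u w hu hw huw
    have h₁ : Γ.Adj u w := (h.adj_iff_left hu hw hs huw).1 ha
    have h₂ : ¬ Γ.Adj w u := fun h₃ => hna ((h.adj_iff_left hw hu (s.symm hs) (s.symm huw)).2 h₃)
    have h₄ : Γ.complement.Adj w u := ⟨(Γ.ne_of_adj h₁).symm, h₂⟩
    exact ⟨h₁, (h'.rel_of_adj h₄).imp r'.symm s'.symm⟩
  -- Here `x, y, w, u` is a rectangle of `Γ` whose diagonals are joined in the complement.
  have side : ∀ {u}, ¬ s x u → r x u → s' x u := by
    intro u hu hxu
    have hyu : ¬ r y u := fun h₁ => hnr (r.trans hxu (r.symm h₁))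
    obtain ⟨w, hyw, hwu⟩ := h.exists_corner y u
    obtain ⟨hauw, hrs⟩ := mixed hxu hyw (s.symm hwu)
    have hxw : ¬ s x w := fun h₁ => hu (s.trans h₁ hwu)
    have hrxw : ¬ r x w := fun h₁ => hnr (r.trans h₁ (r.symm hyw))
    rcases hy hu hyu with h₁ | h₁
    · rcases hx hxw hrxw with h₂ | h₂
      · rcases hrs with h₃ | h₃
        · exact absurd (r'.trans h₂ (r'.symm (r'.trans h₁ h₃))) hnr'
        -- In the complement `y → x` and `u → w` would be parallel sides of a rectangle, yet only
        -- the first is an arc there.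
        · exact absurd hauw ((h'.adj_iff_left h₁ h₂ (s'.symm hs') h₃).1 hcyx).2
      · rcases hrs with h₃ | h₃
        · have := h'.eq_of_rel (r'.trans h₁ h₃) (s'.trans (s'.symm hs') h₂)
          exact absurd (this ▸ hs) hxw
        · exact s'.trans h₂ (s'.symm h₃)
    · exact s'.trans hs' h₁
  by_cases hxz : r x z
  · exact side hz hxz
  rcases hx hz hxz with h₁ | h₁
  · by_cases hyz : r y z
    · obtain ⟨w, hxw, hwz⟩ := h.exists_corner x z
      have hw : ¬ s x w := fun h₂ => hz (s.trans h₂ hwz)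
      have hw' := side hw hxw
      rcases (mixed hxw hyz hwz).2 with h₃ | h₃
      · have := h'.eq_of_rel (r'.trans h₁ (r'.symm h₃)) hw'
        exact absurd (this ▸ s.refl x) hw
      · exact s'.trans hw' h₃
    · rcases hy hz hyz with h₂ | h₂
      · exact absurd (r'.trans h₁ (r'.symm h₂)) hnr'
      · exact s'.trans hs' h₂
  · exact h₁

/-- `rel_of_not_rel` says nothing about the `s`-class of `x`; a parallel copy `u → v` of the arc in
another `s`-class serves as a second base and covers it. -/
theorem IsFactorization.forall_rel_of_complement {Γ : LooplessDigraph V} {r s r' s' : Setoid V}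
    (h : Γ.IsFactorization r s) (h' : Γ.complement.IsFactorization r' s') {x y : V}
    (ha : Γ.Adj x y) (hna : ¬ Γ.Adj y x) (hs : s x y) (hs' : s' x y)
    (hsall : ¬ ∀ x y, s x y) : ∀ u v, s' u v := by
  obtain ⟨w, hw⟩ := exists_not_rel hsall x
  obtain ⟨u, hxu, huw⟩ := h.exists_corner x w
  have hu : ¬ s x u := fun h₁ => hw (s.trans h₁ huw)
  obtain ⟨v, hyv, hvu⟩ := h.exists_corner y u
  have hv : ¬ s x v := fun h₁ => hu (s.trans h₁ hvu)
  have huv := s.symm hvu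
  have hau : Γ.Adj u v := (h.adj_iff_left hxu hyv hs huv).1 ha
  have hnau : ¬ Γ.Adj v u := fun h₃ => hna ((h.adj_iff_left hyv hxu (s.symm hs) hvu).2 h₃)
  have hxu' := h.rel_of_not_rel h' ha hna hs hs' hu
  have hxv' := h.rel_of_not_rel h' ha hna hs hs' hv
  have key : ∀ z, s' x z := by
    intro z
    by_cases hz : s x z
    · exact s'.trans hxu' (h.rel_of_not_rel h' hau hnau huv (s'.trans (s'.symm hxu') hxv')
        fun h₁ => hu (s.trans hz (s.symm h₁)))
    · exact h.rel_of_not_rel h' ha hna hs hs' hz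
  exact fun a b => s'.trans (s'.symm (key a)) (key b)

theorem IsFactorization.complement_isIndecomposable {Γ : LooplessDigraph V}
    {r s : Setoid V} (h : Γ.IsFactorization r s) (hr : ¬ ∀ x y, r x y) (hs : ¬ ∀ x y, s x y)
    (hp : Γ.IsProper) : Γ.complement.IsIndecomposable := by
  intro r' s' h'
  obtain ⟨x, y, ha, hna⟩ := isProper_iff.1 hp
  have hc : Γ.complement.Adj y x := ⟨(Γ.ne_of_adj ha).symm, hna⟩
  rcases h'.rel_of_adj hc with h₂ | h₂
  · left
    rcases h.rel_of_adj ha with h₁ | h₁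
    · exact h.swap.forall_rel_of_complement h'.swap ha hna h₁ (r'.symm h₂) hr
    · exact h.forall_rel_of_complement h'.swap ha hna h₁ (r'.symm h₂) hs
  · right
    rcases h.rel_of_adj ha with h₁ | h₁
    · exact h.swap.forall_rel_of_complement h' ha hna h₁ (s'.symm h₂) hr
    · exact h.forall_rel_of_complement h' ha hna h₁ (s'.symm h₂) hs

theorem complement_isWeaklyConnected_of_not [Nonempty V] {Γ : LooplessDigraph V}
    (h : ¬ Γ.IsWeaklyConnected) : Γ.complement.IsWeaklyConnected := by
  have hle : (SimpleGraph.fromRel Γ.Adj)ᶜ ≤ SimpleGraph.fromRel Γ.complement.Adj := by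
    intro u v huv
    rw [SimpleGraph.compl_adj, SimpleGraph.fromRel_adj] at huv
    exact (SimpleGraph.fromRel_adj _ _ _).2
      ⟨huv.1, Or.inl ⟨huv.1, fun h' => huv.2 ⟨huv.1, Or.inl h'⟩⟩⟩
  exact ((SimpleGraph.fromRel Γ.Adj).connected_or_connected_compl.resolve_left h).mono hle

theorem IsProper.exists_isWeaklyConnected_isIndecomposable [Nonempty V] {Γ : LooplessDigraph V}
    (hp : Γ.IsProper) : ∃ Δ : LooplessDigraph V, (Δ = Γ ∨ Δ = Γ.complement) ∧
      Δ.IsWeaklyConnected ∧ Δ.IsIndecomposable := by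
  by_cases hi : Γ.IsIndecomposable
  · by_cases hc : Γ.IsWeaklyConnected
    · exact ⟨Γ, Or.inl rfl, hc, hi⟩
    · refine ⟨_, Or.inr rfl, complement_isWeaklyConnected_of_not hc, ?_⟩
      -- If the complement split, its own complement `Γ` would be weakly connected.
      intro r s h
      by_contra! hrs
      refine hc (Γ.complement_complement ▸ h.complement_isWeaklyConnected ?_ ?_ hp.complement)
      · push Not; exact hrs.1
      · push Not; exact hrs.2
  · simp only [IsIndecomposable, not_forall, not_or, exists_prop] at hi
    obtain ⟨r, s, h, hr, hs⟩ := hi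
    refine ⟨_, Or.inr rfl, h.complement_isWeaklyConnected ?_ ?_ hp,
      h.complement_isIndecomposable ?_ ?_ hp⟩ <;> push Not <;> assumption

end LooplessDigraph

/-! ### Automorphisms, box products and Cayley indices -/

namespace LooplessDigraph

section Aut

variable {V W : Type*}

theorem mem_aut {Γ : LooplessDigraph V} {σ : Equiv.Perm V} :
    σ ∈ Γ.aut ↔ ∀ u v, Γ.Adj (σ u) (σ v) ↔ Γ.Adj u v := Iff.rfl

theorem aut_le_aut_complement (Γ : LooplessDigraph V) : Γ.aut ≤ Γ.complement.aut := by
  intro σ h u v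
  change (σ u ≠ σ v ∧ ¬ Γ.Adj (σ u) (σ v)) ↔ (u ≠ v ∧ ¬ Γ.Adj u v)
  rw [mem_aut.1 h u v, σ.injective.ne_iff]

theorem aut_complement (Γ : LooplessDigraph V) : Γ.complement.aut = Γ.aut := by
  refine le_antisymm ?_ Γ.aut_le_aut_complement
  simpa only [complement_complement] using Γ.complement.aut_le_aut_complement

theorem boxProd_adj {Γ : LooplessDigraph V} {Δ : LooplessDigraph W} {x y : V × W} :
    (Γ.boxProd Δ).Adj x y ↔ (x.1 = y.1 ∧ Δ.Adj x.2 y.2) ∨ (x.2 = y.2 ∧ Γ.Adj x.1 y.1) := Iff.rfl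

theorem boxProd_adj_of_fst_eq {Γ : LooplessDigraph V} {Δ : LooplessDigraph W} {x y : V × W}
    (h : x.1 = y.1) : (Γ.boxProd Δ).Adj x y ↔ Δ.Adj x.2 y.2 := by
  rw [boxProd_adj, h]
  exact ⟨fun h' => h'.elim (fun h' => h'.2) fun h' => absurd h'.2 (Γ.loopless _),
    fun h' => Or.inl ⟨rfl, h'⟩⟩

theorem boxProd_adj_of_snd_eq {Γ : LooplessDigraph V} {Δ : LooplessDigraph W} {x y : V × W}
    (h : x.2 = y.2) : (Γ.boxProd Δ).Adj x y ↔ Γ.Adj x.1 y.1 := by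
  rw [boxProd_adj, h]
  exact ⟨fun h' => h'.elim (fun h' => absurd h'.2 (Δ.loopless _)) fun h' => h'.2,
    fun h' => Or.inr ⟨rfl, h'⟩⟩

theorem IsProper.boxProd [Nonempty W] {Γ : LooplessDigraph V} (hp : Γ.IsProper)
    (Δ : LooplessDigraph W) : (Γ.boxProd Δ).IsProper := by
  obtain ⟨u, v, h₁, h₂⟩ := isProper_iff.1 hp
  obtain ⟨w⟩ := ‹Nonempty W›
  refine isProper_iff.2 ⟨(u, w), (v, w), ?_, ?_⟩
  · rwa [boxProd_adj_of_snd_eq (by rfl)]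
  · rwa [boxProd_adj_of_snd_eq (by rfl)]

theorem permGroupProd_aut_le (Γ : LooplessDigraph V) (Δ : LooplessDigraph W) :
    permGroupProd Γ.aut Δ.aut ≤ (Γ.boxProd Δ).aut := by
  rintro σ ⟨a, ha, b, hb, h⟩ ⟨u, w⟩ ⟨u', w'⟩
  simp only [h, boxProd_adj, a.injective.eq_iff, b.injective.eq_iff, mem_aut.1 ha, mem_aut.1 hb]

end Aut

section Cayley

variable {G H : Type*} [Group G] [Group H]

theorem IsCayley.adj_mul_right {Γ : LooplessDigraph G} (h : Γ.IsCayley) (u v g : G) :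
    Γ.Adj (u * g) (v * g) ↔ Γ.Adj u v := by
  obtain ⟨S, hS, rfl⟩ := h
  change v * g * (u * g)⁻¹ ∈ S ↔ v * u⁻¹ ∈ S
  rw [mul_inv_rev, mul_assoc, mul_inv_cancel_left]

theorem isCayley_of_adj_mul_right {Γ : LooplessDigraph G}
    (h : ∀ u v g, Γ.Adj (u * g) (v * g) ↔ Γ.Adj u v) : Γ.IsCayley := by
  refine ⟨{g | Γ.Adj 1 g}, Γ.loopless 1, ?_⟩
  obtain ⟨⟨Adj⟩, hl⟩ := Γ
  simp only [cayley, mk.injEq, Digraph.mk.injEq]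
  ext u v
  simpa using (h u v u⁻¹).symm

theorem IsCayley.complement {Γ : LooplessDigraph G} (h : Γ.IsCayley) : Γ.complement.IsCayley := by
  refine isCayley_of_adj_mul_right fun u v g => ?_
  change (u * g ≠ v * g ∧ ¬ Γ.Adj (u * g) (v * g)) ↔ (u ≠ v ∧ ¬ Γ.Adj u v)
  rw [h.adj_mul_right, (mul_left_injective g).ne_iff]

theorem IsCayley.boxProd {Γ : LooplessDigraph G} {Δ : LooplessDigraph H} (h : Γ.IsCayley)
    (h' : Δ.IsCayley) : (Γ.boxProd Δ).IsCayley := by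
  refine isCayley_of_adj_mul_right fun u v g => ?_
  simp only [boxProd_adj, Prod.fst_mul, Prod.snd_mul, h.adj_mul_right, h'.adj_mul_right,
    mul_left_inj]

theorem mem_rightRegular {σ : Equiv.Perm G} :
    σ ∈ rightRegular G ↔ ∃ g : G, ∀ x, σ x = x * g := by
  constructor
  · rintro ⟨g, rfl⟩
    exact ⟨g.unop, fun x => rfl⟩
  · rintro ⟨g, hg⟩
    exact ⟨MulOpposite.op g, Equiv.ext fun x => (hg x).symm⟩

theorem card_rightRegular : Nat.card (rightRegular G) = Nat.card G := by
  have hinj : Function.Injective (MulAction.toPermHom Gᵐᵒᵖ G) := MulAction.toPerm_injective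
  rw [rightRegular, ← Nat.card_congr (MonoidHom.ofInjective hinj).toEquiv]
  exact Nat.card_congr MulOpposite.opEquiv.symm

theorem IsCayley.rightRegular_le {Γ : LooplessDigraph G} (h : Γ.IsCayley) :
    rightRegular G ≤ Γ.aut := by
  intro σ hσ u v
  obtain ⟨g, hg⟩ := mem_rightRegular.1 hσ
  rw [hg, hg, h.adj_mul_right]

theorem IsCayley.cayleyIndex_mul_card {Γ : LooplessDigraph G} (h : Γ.IsCayley) :
    Nat.card G * Γ.cayleyIndex = Nat.card Γ.aut := by
  have := Subgroup.card_mul_index ((rightRegular G).subgroupOf Γ.aut)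
  rwa [Nat.card_congr (Subgroup.subgroupOfEquivOfLe h.rightRegular_le).toEquiv,
    card_rightRegular] at this

/-- Orbit-stabilizer: right translations act transitively. This turns a comparison of Cayley indices
into one of point stabilizers. -/
theorem IsCayley.card_stabilizer [Finite G] {Γ : LooplessDigraph G} (h : Γ.IsCayley) (x : G) :
    Nat.card (MulAction.stabilizer Γ.aut x) = Γ.cayleyIndex := by
  have : MulAction.IsPretransitive Γ.aut G := ⟨fun u v => by
    have hm : Equiv.mulRight (u⁻¹ * v) ∈ Γ.aut := fun a b => h.adj_mul_right a b _
    exact ⟨⟨_, hm⟩, mul_inv_cancel_left u v⟩⟩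
  have h₁ := Subgroup.card_mul_index (MulAction.stabilizer Γ.aut x)
  rw [MulAction.index_stabilizer_of_transitive, ← h.cayleyIndex_mul_card, mul_comm] at h₁
  exact Nat.eq_of_mul_eq_mul_left Nat.card_pos h₁

end Cayley

end LooplessDigraph

theorem card_permGroupProd {V W : Type*} [Nonempty V] [Nonempty W] (A : Subgroup (Equiv.Perm V))
    (B : Subgroup (Equiv.Perm W)) :
    Nat.card (permGroupProd A B) = Nat.card A * Nat.card B := by
  rw [← Nat.card_prod]
  symm
  refine Nat.card_eq_of_bijective
    (fun p : A × B => (⟨Equiv.prodCongr p.1.1 p.2.1, p.1.1, p.1.2, p.2.1, p.2.2,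
      fun _ _ => rfl⟩ : permGroupProd A B)) ⟨?_, ?_⟩
  · rintro ⟨⟨a, ha⟩, ⟨b, hb⟩⟩ ⟨⟨a', ha'⟩, ⟨b', hb'⟩⟩ h
    have h' : ∀ x : V × W, (a x.1, b x.2) = (a' x.1, b' x.2) := fun x =>
      DFunLike.congr_fun (Subtype.ext_iff.1 h) x
    obtain ⟨v⟩ := ‹Nonempty V›
    obtain ⟨w⟩ := ‹Nonempty W›
    have h₁ : a = a' := Equiv.ext fun u => congrArg Prod.fst (h' (u, w))
    have h₂ : b = b' := Equiv.ext fun u => congrArg Prod.snd (h' (v, u))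
    subst h₁ h₂
    rfl
  · rintro ⟨σ, a, ha, b, hb, h⟩
    exact ⟨(⟨a, ha⟩, ⟨b, hb⟩), Subtype.ext (Equiv.ext fun x => (h x.1 x.2).symm)⟩

/-! ### Geodesics and automorphisms of box products -/

namespace LooplessDigraph

variable {V W : Type*}

/-- The distance in the underlying simple graph. -/
noncomputable def dist (Γ : LooplessDigraph V) (x y : V) : ℕ :=
  (SimpleGraph.fromRel Γ.Adj).dist x y

theorem fromRel_boxProd (Γ : LooplessDigraph V) (Δ : LooplessDigraph W) :
    SimpleGraph.fromRel (Γ.boxProd Δ).Adj =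
      (SimpleGraph.fromRel Γ.Adj).boxProd (SimpleGraph.fromRel Δ.Adj) := by
  ext x y
  simp only [SimpleGraph.fromRel_adj, SimpleGraph.boxProd_adj, boxProd_adj, Ne, Prod.ext_iff]
  have h₁ := Γ.loopless
  have h₂ := Δ.loopless
  grind

theorem dist_boxProd {Γ : LooplessDigraph V} {Δ : LooplessDigraph W} (hΓ : Γ.IsWeaklyConnected)
    (hΔ : Δ.IsWeaklyConnected) (x y : V × W) :
    (Γ.boxProd Δ).dist x y = Γ.dist x.1 y.1 + Δ.dist x.2 y.2 := by
  have h := SimpleGraph.edist_boxProd (G := SimpleGraph.fromRel Γ.Adj)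
    (H := SimpleGraph.fromRel Δ.Adj) x y
  rw [dist, dist, dist, fromRel_boxProd]
  rw [← ((SimpleGraph.Connected.boxProd hΓ hΔ).preconnected x y).coe_dist_eq_edist,
    ← (hΓ.preconnected _ _).coe_dist_eq_edist, ← (hΔ.preconnected _ _).coe_dist_eq_edist] at h
  exact_mod_cast h

theorem dist_aut {Γ : LooplessDigraph V} {σ : Equiv.Perm V} (hσ : σ ∈ Γ.aut) (x y : V) :
    Γ.dist (σ x) (σ y) = Γ.dist x y := by
  let e : SimpleGraph.fromRel Γ.Adj ≃g SimpleGraph.fromRel Γ.Adj :=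
    ⟨σ, by
      intro a b
      simp only [SimpleGraph.fromRel_adj, mem_aut.1 hσ, σ.injective.ne_iff]⟩
  have hle : ∀ (e : SimpleGraph.fromRel Γ.Adj ≃g SimpleGraph.fromRel Γ.Adj) (x y : V),
      (SimpleGraph.fromRel Γ.Adj).edist (e x) (e y) ≤ (SimpleGraph.fromRel Γ.Adj).edist x y := by
    intro e x y
    by_cases h : (SimpleGraph.fromRel Γ.Adj).edist x y = ⊤
    · rw [h]; exact le_top
    · obtain ⟨w, hw⟩ := SimpleGraph.exists_walk_of_edist_ne_top h
      rw [← hw, ← w.length_map e.toHom]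
      exact SimpleGraph.edist_le _
  have h : (SimpleGraph.fromRel Γ.Adj).edist (e x) (e y) =
      (SimpleGraph.fromRel Γ.Adj).edist x y :=
    le_antisymm (hle e x y) (by simpa using hle e.symm (e x) (e y))
  exact congrArg ENat.toNat h

/-- `z` lies on a geodesic from `x` to `y` in the underlying simple graph. -/
def Btw (Γ : LooplessDigraph V) (x z y : V) : Prop :=
  Γ.dist x z + Γ.dist z y = Γ.dist x y

theorem Btw.map {Γ : LooplessDigraph V} {x y z : V} (h : Γ.Btw x z y) {σ : Equiv.Perm V}
    (hσ : σ ∈ Γ.aut) : Γ.Btw (σ x) (σ z) (σ y) := by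
  simpa only [Btw, dist_aut hσ] using h

theorem btw_self {Γ : LooplessDigraph V} (hΓ : Γ.IsWeaklyConnected) {x z : V}
    (h : Γ.Btw x z x) : z = x := by
  have h' : Γ.dist x x = 0 := SimpleGraph.dist_self
  have h₁ : Γ.dist z x = 0 := by
    rw [Btw] at h
    omega
  exact (SimpleGraph.Connected.dist_eq_zero_iff hΓ).1 h₁

theorem IsWeaklyConnected.dist_triangle {Γ : LooplessDigraph V} (hΓ : Γ.IsWeaklyConnected)
    (x z y : V) : Γ.dist x y ≤ Γ.dist x z + Γ.dist z y :=
  SimpleGraph.Connected.dist_triangle hΓ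

/-- Distances add over the coordinates, so equality in the triangle inequality means equality in
each coordinate. -/
theorem btw_boxProd {Γ : LooplessDigraph V} {Δ : LooplessDigraph W} (hΓ : Γ.IsWeaklyConnected)
    (hΔ : Δ.IsWeaklyConnected) {x y z : V × W} :
    (Γ.boxProd Δ).Btw x z y ↔ Γ.Btw x.1 z.1 y.1 ∧ Δ.Btw x.2 z.2 y.2 := by
  simp only [Btw, dist_boxProd hΓ hΔ]
  have h₁ := hΓ.dist_triangle x.1 z.1 y.1
  have h₂ := hΔ.dist_triangle x.2 z.2 y.2
  omega

theorem btw_left (Γ : LooplessDigraph V) (x y : V) : Γ.Btw x x y := by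
  simp [Btw, dist]

theorem btw_right (Γ : LooplessDigraph V) (x y : V) : Γ.Btw x y y := by
  simp [Btw, dist]

/-- The corner of two points of the image lies on a geodesic between them. Its preimage lies on a
geodesic between two points of the layer, hence in the layer. -/
theorem isFactorization_of_mem_aut {Γ : LooplessDigraph V} {Δ : LooplessDigraph W}
    (hΓ : Γ.IsWeaklyConnected) (hΔ : Δ.IsWeaklyConnected) {σ : Equiv.Perm (V × W)}
    (hσ : σ ∈ (Γ.boxProd Δ).aut) (w : W) :
    Γ.IsFactorization (Setoid.ker fun v => (σ (v, w)).1) (Setoid.ker fun v => (σ (v, w)).2) := by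
  have hadj : ∀ u v, Γ.Adj u v ↔ (Γ.boxProd Δ).Adj (σ (u, w)) (σ (v, w)) := fun u v => by
    rw [mem_aut.1 hσ, boxProd_adj_of_snd_eq (by rfl)]
  refine ⟨?_, ?_, ?_, ?_, ?_⟩
  · intro x y h₁ h₂
    exact congrArg Prod.fst (σ.injective (Prod.ext h₁ h₂))
  · intro x y
    have hb : (Γ.boxProd Δ).Btw (σ (x, w)) ((σ (x, w)).1, (σ (y, w)).2) (σ (y, w)) :=
      (btw_boxProd hΓ hΔ).2 ⟨btw_left _ _ _, btw_right _ _ _⟩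
    have hb' := hb.map (inv_mem hσ)
    have hinv : ∀ p, σ⁻¹ (σ p) = p := σ.symm_apply_apply
    rw [hinv, hinv] at hb'
    have hz := btw_self hΔ ((btw_boxProd hΓ hΔ).1 hb').2
    set z := σ⁻¹ ((σ (x, w)).1, (σ (y, w)).2)
    have hσz : σ (z.1, w) = ((σ (x, w)).1, (σ (y, w)).2) := by
      have : (z.1, w) = z := Prod.ext rfl hz.symm
      rw [this]
      exact σ.apply_symm_apply _
    refine ⟨z.1, ?_, ?_⟩
    · change (σ (x, w)).1 = (σ (z.1, w)).1
      rw [hσz]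
    · change (σ (z.1, w)).2 = (σ (y, w)).2
      rw [hσz]
  · intro x y h
    rw [hadj, boxProd_adj] at h
    exact h.imp And.left And.left
  · intro x y x' y' h₁ h₂ h₃ h₄
    rw [hadj, hadj, boxProd_adj_of_snd_eq h₃, boxProd_adj_of_snd_eq h₄]
    change (σ (x, w)).1 = (σ (x', w)).1 at h₁
    change (σ (y, w)).1 = (σ (y', w)).1 at h₂
    rw [h₁, h₂]
  · intro x y x' y' h₁ h₂ h₃ h₄
    rw [hadj, hadj, boxProd_adj_of_fst_eq h₃, boxProd_adj_of_fst_eq h₄]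
    change (σ (x, w)).2 = (σ (x', w)).2 at h₁
    change (σ (y, w)).2 = (σ (y', w)).2 at h₂
    rw [h₁, h₂]

/-- Conjugating `a × 1` by `σ` gives an automorphism that preserves `{v₀} × W`. Its restriction
there determines `a`, because the layer at `w` is embedded in `{v₀} × W`. -/
theorem card_stabilizer_le [Finite W] {Γ : LooplessDigraph V} {Δ : LooplessDigraph W}
    (hΓ : Γ.IsWeaklyConnected) (hΔ : Δ.IsWeaklyConnected) {σ : Equiv.Perm (V × W)}
    (hσ : σ ∈ (Γ.boxProd Δ).aut) {w : W} {v₀ : V} (h : ∀ v, (σ (v, w)).1 = v₀) (v : V) :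
    Nat.card (MulAction.stabilizer Γ.aut v) ≤
      Nat.card (MulAction.stabilizer Δ.aut (σ (v, w)).2) := by
  -- `(u', x)` lies between `(u, x)` and `(u', w)`, whose images both have first coordinate `v₀`.
  have hbox : ∀ u u' x, (σ (u, x)).1 = v₀ → (σ (u', x)).1 = v₀ := by
    intro u u' x hx
    have hb : (Γ.boxProd Δ).Btw (u, x) (u', x) (u', w) :=
      (btw_boxProd hΓ hΔ).2 ⟨btw_right _ _ _, btw_left _ _ _⟩
    have hb' := ((btw_boxProd hΓ hΔ).1 (hb.map hσ)).1
    rw [hx, h u'] at hb'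
    exact btw_self hΓ hb'
  let conj : Equiv.Perm V → Equiv.Perm (V × W) := fun a => σ * Equiv.prodCongr a 1 * σ⁻¹
  have hconj : ∀ a u x, conj a (σ (u, x)) = σ (a u, x) := fun a u x => by
    simp [conj, Equiv.Perm.mul_apply]
  have hconj_mem : ∀ a ∈ Γ.aut, conj a ∈ (Γ.boxProd Δ).aut := fun a ha =>
    mul_mem (mul_mem hσ (permGroupProd_aut_le Γ Δ ⟨a, ha, 1, one_mem _, fun _ _ => rfl⟩))
      (inv_mem hσ)
  have hfst : ∀ a x, (conj a (v₀, x)).1 = v₀ := by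
    intro a x
    obtain ⟨⟨u, y⟩, hp⟩ := σ.surjective (v₀, x)
    rw [← hp, hconj]
    exact hbox u _ y (by rw [hp])
  have hinj : ∀ a, Function.Injective fun x => (conj a (v₀, x)).2 := by
    intro a x y hxy
    exact congrArg Prod.snd ((conj a).injective (Prod.ext ((hfst a x).trans (hfst a y).symm) hxy))
  let restr : Equiv.Perm V → Equiv.Perm W := fun a =>
    Equiv.ofBijective _ (Finite.injective_iff_bijective.1 (hinj a))
  have hrestr : ∀ a x, restr a x = (conj a (v₀, x)).2 := fun _ _ => rfl
  have hrestr_mem : ∀ a ∈ Γ.aut, restr a ∈ Δ.aut := by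
    intro a ha x y
    have := mem_aut.1 (hconj_mem a ha) (v₀, x) (v₀, y)
    rwa [boxProd_adj_of_fst_eq (by rw [hfst, hfst]), boxProd_adj_of_fst_eq (by rfl)] at this
  have hrestr_apply : ∀ a u, restr a (σ (u, w)).2 = (σ (a u, w)).2 := by
    intro a u
    rw [hrestr, ← hconj, ← h u]
  refine Nat.card_le_card_of_injective
    (fun a : MulAction.stabilizer Γ.aut v =>
      (⟨⟨restr a.1.1, hrestr_mem _ a.1.2⟩, ?_⟩ : MulAction.stabilizer Δ.aut (σ (v, w)).2)) ?_
  · have ha : a.1.1 v = v := a.2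
    change restr a.1.1 (σ (v, w)).2 = (σ (v, w)).2
    rw [hrestr_apply, ha]
  · rintro ⟨⟨a, ha⟩, hav⟩ ⟨⟨b, hb⟩, hbv⟩ hab
    have h₁ : restr a = restr b := Subtype.ext_iff.1 (Subtype.ext_iff.1 hab)
    have h₂ : a = b := by
      ext u
      have h₃ : (σ (a u, w)).2 = (σ (b u, w)).2 := by
        rw [← hrestr_apply, ← hrestr_apply, h₁]
      exact congrArg Prod.fst (σ.injective (Prod.ext ((h _).trans (h _).symm) h₃))
    subst h₂
    rfl

/-- An arc along `W` joins distinct layers, and so does its image, which therefore keeps its first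
coordinate constant; connectedness of `Δ` spreads this over all of `W`. -/
theorem mem_permGroupProd_of_layers [Finite V] [Finite W] [Nonempty V] {Γ : LooplessDigraph V}
    {Δ : LooplessDigraph W} (hΔ : Δ.IsWeaklyConnected) {σ : Equiv.Perm (V × W)}
    (hσ : σ ∈ (Γ.boxProd Δ).aut) (h : ∀ w v v', (σ (v, w)).2 = (σ (v', w)).2) :
    σ ∈ permGroupProd Γ.aut Δ.aut := by
  obtain ⟨v₀⟩ := ‹Nonempty V›
  obtain ⟨w₀⟩ := hΔ.nonempty
  have hlayer : ∀ w, Function.Injective fun v => (σ (v, w)).1 := fun w v v' hv =>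
    congrArg Prod.fst (σ.injective (Prod.ext hv (h w v v')))
  -- By finiteness each layer fills its target layer, so distinct layers have distinct targets.
  have hb : Function.Injective fun w => (σ (v₀, w)).2 := by
    intro w w' hw
    obtain ⟨v, hv⟩ := (Finite.injective_iff_surjective.1 (hlayer w')) (σ (v₀, w)).1
    have : σ (v, w') = σ (v₀, w) := Prod.ext hv ((h w' v v₀).trans hw.symm)
    exact (congrArg Prod.snd (σ.injective this)).symm
  have hstep : ∀ v w w', Δ.Adj w w' → (σ (v, w)).1 = (σ (v, w')).1 := by
    intro v w w' hww
    have ha : (Γ.boxProd Δ).Adj (σ (v, w)) (σ (v, w')) := by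
      rwa [mem_aut.1 hσ, boxProd_adj_of_fst_eq (by rfl)]
    rcases ha with ha | ha
    · exact ha.1
    · have := hb ((h w v₀ v).trans (ha.1.trans (h w' v v₀)))
      exact absurd this (Δ.ne_of_adj hww)
  have hconst : ∀ v w, (σ (v, w)).1 = (σ (v, w₀)).1 := by
    intro v w
    obtain ⟨p⟩ := hΔ.preconnected w w₀
    induction p with
    | nil => rfl
    | cons hadj _ ih =>
      rw [← ih]
      rcases ((SimpleGraph.fromRel_adj _ _ _).1 hadj).2 with h' | h'
      · exact hstep _ _ _ h'
      · exact (hstep _ _ _ h').symm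
  refine ⟨Equiv.ofBijective _ (Finite.injective_iff_bijective.1 (hlayer w₀)), ?_,
    Equiv.ofBijective _ (Finite.injective_iff_bijective.1 hb), ?_, ?_⟩
  · intro u v
    have := mem_aut.1 hσ (u, w₀) (v, w₀)
    rwa [boxProd_adj_of_snd_eq (h _ _ _), boxProd_adj_of_snd_eq (by rfl)] at this
  · intro u v
    have := mem_aut.1 hσ (v₀, u) (v₀, v)
    rwa [boxProd_adj_of_fst_eq (by rw [hconst, hconst v₀ v]), boxProd_adj_of_fst_eq (by rfl)] at this
  · intro v w
    exact Prod.ext (hconst v w) (h w v v₀)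

theorem aut_boxProd_eq [Finite V] [Finite W] {Γ : LooplessDigraph V} {Δ : LooplessDigraph W}
    (hΓ : Γ.IsWeaklyConnected) (hi : Γ.IsIndecomposable) (hΔ : Δ.IsWeaklyConnected)
    (hlt : ∀ (v : V) (w : W), Nat.card (MulAction.stabilizer Δ.aut w) <
      Nat.card (MulAction.stabilizer Γ.aut v)) :
    (Γ.boxProd Δ).aut = permGroupProd Γ.aut Δ.aut := by
  have : Nonempty V := hΓ.nonempty
  refine le_antisymm (fun σ hσ => mem_permGroupProd_of_layers hΔ hσ fun w => ?_)
    (permGroupProd_aut_le Γ Δ)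
  refine (hi _ _ (isFactorization_of_mem_aut hΓ hΔ hσ w)).resolve_left fun hr => ?_
  obtain ⟨v⟩ := this
  exact (hlt v _).not_ge (card_stabilizer_le hΓ hΔ hσ (fun u => hr u v) v)

end LooplessDigraph

theorem corollary2p5 {G H : Type*} [Group G] [Finite G] [Group H] [Finite H]
    (Γ₁ : LooplessDigraph G) (Γ₂ : LooplessDigraph H) (i₁ i₂ : ℕ)
    (hΓ₁ : Γ₁.IsCayley) (hproper : Γ₁.IsProper) (hi₁ : Γ₁.cayleyIndex = i₁)
    (hΓ₂ : Γ₂.IsCayley) (hconn : Γ₂.IsWeaklyConnected) (hi₂ : Γ₂.cayleyIndex = i₂)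
    (hlt : i₂ < i₁) :
    ∃ Δ : LooplessDigraph G, (Δ = Γ₁ ∨ Δ = Γ₁.complement) ∧
      (Δ.boxProd Γ₂).aut = permGroupProd Γ₁.aut Γ₂.aut ∧
      (Δ.boxProd Γ₂).IsCayley ∧
      (Δ.boxProd Γ₂).IsProper ∧
      (Δ.boxProd Γ₂).cayleyIndex = i₁ * i₂ := by
  obtain ⟨Δ, hΔ, hc, hi⟩ := hproper.exists_isWeaklyConnected_isIndecomposable
  have haut : Δ.aut = Γ₁.aut := by
    rcases hΔ with rfl | rfl
    · rfl
    · exact Γ₁.aut_complement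
  have hcay : Δ.IsCayley := by
    rcases hΔ with rfl | rfl
    · exact hΓ₁
    · exact hΓ₁.complement
  have hprop : Δ.IsProper := by
    rcases hΔ with rfl | rfl
    · exact hproper
    · exact hproper.complement
  have hidx : Δ.cayleyIndex = i₁ := by
    rw [← hi₁, LooplessDigraph.cayleyIndex, haut, LooplessDigraph.cayleyIndex]
  have hprod : (Δ.boxProd Γ₂).aut = permGroupProd Δ.aut Γ₂.aut :=
    LooplessDigraph.aut_boxProd_eq hc hi hconn fun v w => by
      rwa [hcay.card_stabilizer, hΓ₂.card_stabilizer, hidx, hi₂]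
  refine ⟨Δ, hΔ, haut ▸ hprod, hcay.boxProd hΓ₂, hprop.boxProd Γ₂, ?_⟩
  have h := (hcay.boxProd hΓ₂).cayleyIndex_mul_card
  rw [hprod, card_permGroupProd, ← hcay.cayleyIndex_mul_card, ← hΓ₂.cayleyIndex_mul_card, hidx,
    hi₂, Nat.card_prod, mul_mul_mul_comm] at h
  exact Nat.eq_of_mul_eq_mul_left (Nat.mul_pos Nat.card_pos Nat.card_pos) h
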